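/- Let $0\le\alpha<1$, $\lambda>0$, $\sigma>0$, and put $\gamma=\sigma^2/\lambda$, $K(s,t)=\alpha^{\max(s,t)}$ for $s,t=1,2,\dots$. For $j=1,2,\dots$ let $$\zeta_j=\frac{1}{(j\pi-\pi/2)^2},\qquad \rho_j(t)=\sqrt2\,\sin\!\left(\frac{\alpha^{t}}{\sqrt{\zeta_j}}\right).$$ Let $u:\mathbb Z\to\mathbb R$ be a known deterministic input and, for a function $f$ on $\{1,2,\dots\}$, let $(f\otimes u)_i=\sum_{k\ge1}f(k)\,u(t_i-k)$ be the discrete-time convolution at the sampling instant $t_i\in\mathbb Z$ ($t_i=i$ in the basic case), $i=1,\dots,N$. Let $g=(g_t)_{t\ge1}$ be a zero-mean Gaussian (causal) process with $\mathbb E[g_sg_t]=\lambda\alpha^{\max(s,t)}$, for which the convolutions $(g\otimes u)_i$ converge absolutely almost surely (as is the case for every bounded $u$). Let $$y_i=(g\otimes u)_i+e_i,\qquad i=1,\dots,N,\qquad Y=(y_1,\dots,y_N)^T,$$ where the $e_i$ are mutually independent Gaussian variables of mean zero and variance $\sigma^2$, independent of $g$. Then: 1. For all $x,x'\in[0,1]$,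 $\min(x,x')=2\sum_{j=1}^\infty\zeta_j\sin(x/\sqrt{\zeta_j})\sin(x'/\sqrt{\zeta_j})$, and for all $s,t\ge1$, $$\alpha^{\max(s,t)}=\sum_{j=1}^\infty\zeta_j\rho_j(s)\rho_j(t).$$ 2. With $h_{ij}=(\rho_j\otimes u)_i$, which is well defined, the problem $$\min_{a}\ \sum_{i=1}^N\Bigl(y_i-\sum_{j=1}^\infty h_{ij}a_j\Bigr)^2+\gamma\sum_{j=1}^\infty\frac{a_j^2}{\zeta_j}$$ over real sequences $a=(a_j)_{j\ge1}$ (the cost being $+\infty$ when the last series diverges; when it converges, so do the series $\sum_j h_{ij}a_j$) has, for every data vector $Y$, a unique minimizer $\hat a$, which has finite cost, and for every $t\ge1$, almost surely, $$\mathbb E[g_t\mid Y]=\sum_{j=1}^\infty\hat a_j\rho_j(t).$$ 3. The series in $$A_{ij}=\sum_{t=1}^\infty u(t_j-t)\Bigl(\sum_{k=1}^\infty u(t_i-k)K(t,k)\Bigr)$$ converge, $A+\gamma I_N$ is invertible, and with $\hat c=(A+\gamma I_N)^{-1}Y$ one has for every $t\ge1$, almost surely, $$\mathbb E[g_t\mid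 Y]=\sum_{i=1}^N\hat c_i\,(K(\cdot,t)\otimes u)_i .$$ -/

import Mathlib

open MeasureTheory ProbabilityTheory
open scoped ENNReal

noncomputable section

/-- Discrete-time convolution `(f ⊗ u)(n) = ∑_{k ≥ 1} f(k) u(n - k)` of a causal impulse response
`f` (supported on the time instants `1, 2, …`) with an input `u`. -/
def conv (f : ℕ+ → ℝ) (u : ℤ → ℝ) (n : ℤ) : ℝ :=
  ∑' k : ℕ+, f k * u (n - (k : ℤ))

/-- The convolution `(f ⊗ u)(n)` is well defined (as an absolutely convergent series). -/
def ConvSummable (f : ℕ+ → ℝ) (u : ℤ → ℝ) (n : ℤ) : Prop :=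
  Summable fun k : ℕ+ => f k * u (n - (k : ℤ))

/-- The first-order stable spline kernel `K(s,t) = α ^ max(s,t)`, for `s, t = 1, 2, …`. -/
def stableSpline (α : ℝ) (s t : ℕ+) : ℝ :=
  α ^ max (s : ℕ) (t : ℕ)

/-- The weights `ζ_j = 1 / (jπ - π/2)²`, for `j = 1, 2, …`. -/
def zeta (j : ℕ+) : ℝ :=
  1 / ((j : ℝ) * Real.pi - Real.pi / 2) ^ 2

/-- The stable spline atoms `ρ_j(t) = √2 sin(α^t / √ζ_j)`. -/
def rho (α : ℝ) (j t : ℕ+) : ℝ :=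
  Real.sqrt 2 * Real.sin (α ^ (t : ℕ) / Real.sqrt (zeta j))

/-- The coefficients `h_{ij} = (ρ_j ⊗ u)_i`, the convolution being evaluated at the sampling
instant `τ i`. -/
def atomOutput {N : ℕ} (α : ℝ) (u : ℤ → ℝ) (τ : Fin N → ℤ) (i : Fin N) (j : ℕ+) : ℝ :=
  conv (rho α j) u (τ i)

/-- The objective
`∑_i (y_i - ∑_j h_{ij} a_j)² + γ ∑_j a_j² / ζ_j`,
with values in `[0, ∞]`: it is `∞` when the penalty series diverges. -/
def ridgeObjective {N : ℕ} (α γ : ℝ) (u : ℤ → ℝ) (τ : Fin N → ℤ) (y : Fin N → ℝ)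
    (a : ℕ+ → ℝ) : ℝ≥0∞ :=
  ENNReal.ofReal (∑ i : Fin N, (y i - ∑' j : ℕ+, atomOutput α u τ i j * a j) ^ 2) +
    ENNReal.ofReal γ * ∑' j : ℕ+, ENNReal.ofReal (a j ^ 2 / zeta j)

/-- `a` minimizes the objective among all real sequences. -/
def IsRidgeMinimizer {N : ℕ} (α γ : ℝ) (u : ℤ → ℝ) (τ : Fin N → ℤ) (y : Fin N → ℝ)
    (a : ℕ+ → ℝ) : Prop :=
  ∀ b : ℕ+ → ℝ, ridgeObjective α γ u τ y a ≤ ridgeObjective α γ u τ y b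

/-- The matrix `A_{ij} = ∑_{t ≥ 1} u(t_j - t) (∑_{k ≥ 1} u(t_i - k) K(t,k))`, where `t_i = τ i` are
the sampling instants. -/
def outputKernel {N : ℕ} (α : ℝ) (u : ℤ → ℝ) (τ : Fin N → ℤ) : Matrix (Fin N) (Fin N) ℝ :=
  Matrix.of fun i j =>
    ∑' t : ℕ+, u (τ j - (t : ℤ)) * ∑' k : ℕ+, u (τ i - (k : ℤ)) * stableSpline α t k

end

/-! The kernel `min x x'` is a difference of two cosine series over odd frequencies, each affine on
`[0, 2]`; substituting `x = α ^ s`, `x' = α ^ t` expands the stable spline kernel. Hence `φ_t =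
(√ζ_j ρ_j(t))_j` is an `ℓ²` feature map with Gram kernel `K`, and `ψ_i = ∑ k, u (τ i - k) • φ_k`
represents the i-th noiseless output. Writing `a_j = √ζ_j b_j` turns the problem over sequences into
ridge regression in `ℓ²`, whose unique solution is `∑ c_i ψ_i` with `c = (gram ψ + γ I)⁻¹ v`
(`hilbertRidgeCost_eq`, `isRidgeMinimizer_iff`), and `gram ψ` is the matrix `A`.

On the probabilistic side the `g_t` are vectors of `L²(P)` with Gram kernel `lam * K`, so the
covariances of `g_t` and the data are `lam` times the same `ℓ²` inner products, plus `σ²` on the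
diagonal. In a space of centered Gaussian variables conditional expectation is orthogonal projection
(`condExp_eq_sum_of_orthogonal`), and its normal equations involve the same matrix `gram ψ + (σ² /
lam) I`.

Convergence of all these series rests on `∑ |u (n - k)| √(α ^ k) < ∞`. This is extracted from the
almost sure convergence of `g ⊗ u` by a truncation argument on first absolute moments
(`summable_abs_mul_sqrt_of_ae_summable`). -/

/-! ### Sine expansions of the Brownian and stable spline kernels. -/

lemma inv_sqrt_zeta (j : ℕ+) : 1 / Real.sqrt (zeta j) = (j : ℝ) * Real.pi - Real.pi / 2 := by
  have hj : (1 : ℝ) ≤ (j : ℝ) := by exact_mod_cast j.pos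
  have hpos : 0 < (j : ℝ) * Real.pi - Real.pi / 2 := by nlinarith [Real.pi_pos]
  rw [zeta, Real.sqrt_div zero_le_one, Real.sqrt_sq hpos.le, Real.sqrt_one, one_div_one_div]

lemma zeta_pos (j : ℕ+) : 0 < zeta j := by
  have hj : (1 : ℝ) ≤ (j : ℝ) := by exact_mod_cast j.pos
  have hpos : 0 < (j : ℝ) * Real.pi - Real.pi / 2 := by nlinarith [Real.pi_pos]
  unfold zeta; positivity

lemma sqrt_zeta_pos (j : ℕ+) : 0 < Real.sqrt (zeta j) := Real.sqrt_pos.2 (zeta_pos j)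

/-- Fourier series of the second Bernoulli polynomial. -/
lemma hasSum_cos_div_sq {x : ℝ} (hx : x ∈ Set.Icc (0 : ℝ) 1) :
    HasSum (fun n : ℕ => 1 / (n : ℝ) ^ 2 * Real.cos (2 * Real.pi * n * x))
      (Real.pi ^ 2 * (x ^ 2 - x + 1 / 6)) := by
  convert! hasSum_one_div_nat_pow_mul_cos one_ne_zero hx using 1
  simp [Polynomial.bernoulli, Finset.sum_range_succ, bernoulli, bernoulli'_two,
    Polynomial.eval_add, Polynomial.eval_monomial, Nat.factorial]
  ring

/-- The cosine series over odd frequencies is affine on `[0, 2]`. -/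
lemma hasSum_zeta_mul_cos {θ : ℝ} (h0 : 0 ≤ θ) (h2 : θ ≤ 2) :
    HasSum (fun j : ℕ+ => zeta j * Real.cos (θ / Real.sqrt (zeta j))) ((1 - θ) / 2) := by
  -- At `θ / 4` the odd frequencies are exactly the `1 / √ζ_j`, up to the factor `θ`; the even terms
  -- form a quarter of the series at `θ / 2`. Subtracting them cancels the quadratic part.
  have hall := hasSum_cos_div_sq (x := θ / 4) ⟨by linarith, by linarith⟩
  have heven := (hasSum_cos_div_sq (x := θ / 2) ⟨by linarith, by linarith⟩).mul_left (1 / 4)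
  set f : ℕ → ℝ := fun n => 1 / (n : ℝ) ^ 2 * Real.cos (2 * Real.pi * n * (θ / 4)) with hf
  have heven' : HasSum (fun m : ℕ => f (2 * m))
      (1 / 4 * (Real.pi ^ 2 * ((θ / 2) ^ 2 - θ / 2 + 1 / 6))) := by
    convert! heven using 2 with m
    simp only [hf]
    push_cast
    rw [show 2 * Real.pi * (2 * (m : ℝ)) * (θ / 4) = 2 * Real.pi * m * (θ / 2) by ring]
    rw [mul_pow, ← mul_assoc, ← one_div_mul_one_div]
    norm_num
  have hinj : Function.Injective fun m : ℕ => 2 * m + 1 := fun a b h => by simpa using h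
  have hodd : HasSum (fun m : ℕ => f (2 * m + 1)) (Real.pi ^ 2 / 4 * ((1 - θ) / 2)) := by
    have hs : Summable fun m : ℕ => f (2 * m + 1) := hall.summable.comp_injective hinj
    have := (heven'.even_add_odd hs.hasSum).unique hall
    convert! hs.hasSum using 1
    linarith
  have h4 := hodd.mul_left (4 / Real.pi ^ 2)
  rw [← mul_assoc, show 4 / Real.pi ^ 2 * (Real.pi ^ 2 / 4) = 1 by field_simp, one_mul,
    ← Equiv.pnatEquivNat.hasSum_iff] at h4
  convert! h4 using 2 with j
  obtain ⟨m, rfl⟩ : ∃ m : ℕ, j = m.succPNat := ⟨j.natPred, by simp⟩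
  have hr : ((m.succPNat : ℕ+) : ℝ) = m + 1 := by simp
  rw [div_eq_mul_one_div θ, inv_sqrt_zeta]
  simp only [Function.comp, Equiv.pnatEquivNat_apply, Nat.natPred_succPNat, hf, zeta, hr]
  push_cast
  rw [show 2 * Real.pi * (2 * (m : ℝ) + 1) * (θ / 4) = θ * ((m + 1) * Real.pi - Real.pi / 2) by
    ring, ← mul_assoc, show ((m : ℝ) + 1) * Real.pi - Real.pi / 2 = Real.pi / 2 * (2 * m + 1) by
    ring]
  congr 1
  field_simp
  norm_num

/-- By `2 sin a sin b = cos (a - b) - cos (a + b)`, the sum is a difference of two affine values, at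
`|x - x'|` and `x + x'`, both in `[0, 2]`: it equals `(x + x' - |x - x'|) / 2`. -/
lemma hasSum_min {x x' : ℝ} (hx : x ∈ Set.Icc (0 : ℝ) 1) (hx' : x' ∈ Set.Icc (0 : ℝ) 1) :
    HasSum (fun j : ℕ+ => zeta j * (Real.sqrt 2 * Real.sin (x / Real.sqrt (zeta j))) *
      (Real.sqrt 2 * Real.sin (x' / Real.sqrt (zeta j)))) (min x x') := by
  have hm := hasSum_zeta_mul_cos (θ := |x - x'|) (abs_nonneg _)
    (by rw [abs_le]; constructor <;> linarith [hx.1, hx.2, hx'.1, hx'.2])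
  have hp := hasSum_zeta_mul_cos (θ := x + x') (by linarith [hx.1, hx'.1])
    (by linarith [hx.2, hx'.2])
  convert! hm.sub hp using 1
  · funext j
    have h2 : Real.sqrt 2 * Real.sqrt 2 = 2 := Real.mul_self_sqrt (by norm_num)
    have habs : Real.cos (|x - x'| / Real.sqrt (zeta j)) =
        Real.cos (x / Real.sqrt (zeta j) - x' / Real.sqrt (zeta j)) := by
      rw [← sub_div, ← Real.cos_abs ((x - x') / _), abs_div, abs_of_pos (sqrt_zeta_pos j)]
    rw [habs, add_div, Real.cos_sub, Real.cos_add]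
    linear_combination zeta j * Real.sin (x / Real.sqrt (zeta j)) *
      Real.sin (x' / Real.sqrt (zeta j)) * h2
  · rcases le_total x x' with h | h
    · rw [min_eq_left h, abs_of_nonpos (by linarith)]; ring
    · rw [min_eq_right h, abs_of_nonneg (by linarith)]; ring

lemma hasSum_stableSpline {α : ℝ} (hα0 : 0 ≤ α) (hα1 : α < 1) (s t : ℕ+) :
    HasSum (fun j : ℕ+ => zeta j * rho α j s * rho α j t) (stableSpline α s t) := by
  have hmem (n : ℕ+) : α ^ (n : ℕ) ∈ Set.Icc (0 : ℝ) 1 :=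
    ⟨pow_nonneg hα0 _, pow_le_one₀ hα0 hα1.le⟩
  have h := hasSum_min (hmem s) (hmem t)
  have hanti : Antitone fun n : ℕ => α ^ n := fun a b hab =>
    pow_le_pow_of_le_one hα0 hα1.le hab
  rwa [← hanti.map_max] at h

lemma stableSpline_comm (α : ℝ) (s t : ℕ+) : stableSpline α s t = stableSpline α t s := by
  simp [stableSpline, max_comm]

/-! ### Weighted series of vectors with Gram kernel `c * K`; used with `c = 1` in `ℓ²` and `c = lam`
in `L²(P)`. -/

section Gram

variable {E : Type*} [NormedAddCommGroup E] [InnerProductSpace ℝ E]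

lemma norm_of_gram_stableSpline {c α : ℝ} (hc : 0 ≤ c) {φ : ℕ+ → E}
    (hφ : ∀ s t, inner ℝ (φ s) (φ t) = c * stableSpline α s t) (t : ℕ+) :
    ‖φ t‖ = Real.sqrt c * Real.sqrt (α ^ (t : ℕ)) := by
  rw [norm_eq_sqrt_real_inner, hφ, Real.sqrt_mul hc]
  simp [stableSpline]

lemma summable_norm_smul_of_gram {c α : ℝ} (hc : 0 ≤ c) {φ : ℕ+ → E}
    (hφ : ∀ s t, inner ℝ (φ s) (φ t) = c * stableSpline α s t) {w : ℕ+ → ℝ}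
    (hw : Summable fun k : ℕ+ => |w k| * Real.sqrt (α ^ (k : ℕ))) :
    Summable fun k => ‖w k • φ k‖ := by
  convert! hw.mul_left (Real.sqrt c) using 2 with k
  rw [norm_smul, norm_of_gram_stableSpline hc hφ, Real.norm_eq_abs]
  ring

variable [CompleteSpace E]

lemma hasSum_inner_of_gram {c α : ℝ} (hc : 0 ≤ c) {φ : ℕ+ → E}
    (hφ : ∀ s t, inner ℝ (φ s) (φ t) = c * stableSpline α s t) {w : ℕ+ → ℝ}
    (hw : Summable fun k : ℕ+ => |w k| * Real.sqrt (α ^ (k : ℕ))) (x : E) :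
    HasSum (fun k => w k * inner ℝ x (φ k)) (inner ℝ x (∑' k, w k • φ k)) := by
  have h := ((summable_norm_smul_of_gram hc hφ hw).of_norm.hasSum).mapL (innerSL ℝ x)
  simpa [innerSL_apply_apply, inner_smul_right] using h

lemma hasSum_stableSpline_of_gram {c α : ℝ} (hc : 0 ≤ c) {φ : ℕ+ → E}
    (hφ : ∀ s t, inner ℝ (φ s) (φ t) = c * stableSpline α s t) {w : ℕ+ → ℝ}
    (hw : Summable fun k : ℕ+ => |w k| * Real.sqrt (α ^ (k : ℕ))) (t : ℕ+) :
    HasSum (fun k => w k * (c * stableSpline α t k)) (inner ℝ (φ t) (∑' k, w k • φ k)) := by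
  simpa only [hφ] using hasSum_inner_of_gram hc hφ hw (φ t)

end Gram

/-! ### Ridge regression in an inner product space. -/

section Ridge

variable {E : Type*} [NormedAddCommGroup E] [InnerProductSpace ℝ E] {N : ℕ}

lemma isUnit_gram_add_smul_one (ψ : Fin N → E) {γ : ℝ} (hγ : 0 < γ) :
    IsUnit (Matrix.gram ℝ ψ + γ • (1 : Matrix (Fin N) (Fin N) ℝ)) :=
  (Matrix.PosDef.posSemidef_add (Matrix.posSemidef_gram ℝ ψ) (Matrix.PosDef.one.smul hγ)).isUnit

/-- The regularized least squares cost in a Hilbert space. -/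
noncomputable def hilbertRidgeCost (ψ : Fin N → E) (γ : ℝ) (v : Fin N → ℝ) (b : E) : ℝ :=
  ∑ i, (v i - inner ℝ (ψ i) b) ^ 2 + γ * ‖b‖ ^ 2

/-- The representer of the regularized least squares solution. -/
noncomputable def hilbertRidgeSolution (ψ : Fin N → E) (γ : ℝ) (v : Fin N → ℝ) : E :=
  ∑ i, Matrix.mulVec (Matrix.gram ℝ ψ + γ • (1 : Matrix (Fin N) (Fin N) ℝ))⁻¹ v i • ψ i

/-- Completing the square: the terms linear in the displacement cancel by the normal equations, and
the remaining excess is strictly positive away from the solution. Minimality and uniqueness both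
follow. -/
lemma hilbertRidgeCost_eq (ψ : Fin N → E) {γ : ℝ} (hγ : 0 < γ) (v : Fin N → ℝ) (b : E) :
    hilbertRidgeCost ψ γ v b = hilbertRidgeCost ψ γ v (hilbertRidgeSolution ψ γ v) +
      ∑ i, (inner ℝ (ψ i) (b - hilbertRidgeSolution ψ γ v)) ^ 2 +
      γ * ‖b - hilbertRidgeSolution ψ γ v‖ ^ 2 := by
  set M := Matrix.gram ℝ ψ + γ • (1 : Matrix (Fin N) (Fin N) ℝ) with hM
  set c := Matrix.mulVec M⁻¹ v with hc
  set z := hilbertRidgeSolution ψ γ v with hz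
  have hzc : z = ∑ i, c i • ψ i := rfl
  have hMc : Matrix.mulVec M c = v := by
    rw [hc, Matrix.mulVec_mulVec, Matrix.mul_nonsing_inv, Matrix.one_mulVec]
    exact (Matrix.isUnit_iff_isUnit_det _).1 (isUnit_gram_add_smul_one ψ hγ)
  -- The normal equations: each residual is `γ` times the corresponding coefficient.
  have hres (i : Fin N) : v i - inner ℝ (ψ i) z = γ * c i := by
    have h := congrFun hMc i
    rw [hM, Matrix.add_mulVec, Matrix.smul_mulVec, Matrix.one_mulVec] at h
    have h2 : inner ℝ (ψ i) z = Matrix.mulVec (Matrix.gram ℝ ψ) c i := by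
      rw [hzc, inner_sum]
      simp [Matrix.mulVec, dotProduct, Matrix.gram_apply, inner_smul_right, mul_comm]
    rw [h2, ← h]
    simp
  obtain ⟨d, rfl⟩ : ∃ d, b = z + d := ⟨b - z, by abel⟩
  have hcross : inner ℝ z d = ∑ i, c i * inner ℝ (ψ i) d := by
    rw [hzc, sum_inner]
    simp [inner_smul_left]
  have hterm (i : Fin N) : (v i - inner ℝ (ψ i) (z + d)) ^ 2 =
      (v i - inner ℝ (ψ i) z) ^ 2 - 2 * γ * (c i * inner ℝ (ψ i) d) +
        (inner ℝ (ψ i) d) ^ 2 := by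
    rw [inner_add_right]
    linear_combination -2 * inner ℝ (ψ i) d * hres i
  simp only [hilbertRidgeCost, add_sub_cancel_left, hterm, Finset.sum_add_distrib,
    Finset.sum_sub_distrib, ← Finset.mul_sum, ← hcross, norm_add_sq_real]
  ring

lemma hilbertRidgeCost_nonneg (ψ : Fin N → E) {γ : ℝ} (hγ : 0 < γ) (v : Fin N → ℝ) (b : E) :
    0 ≤ hilbertRidgeCost ψ γ v b := by
  unfold hilbertRidgeCost
  positivity

lemma hilbertRidgeCost_solution_le (ψ : Fin N → E) {γ : ℝ} (hγ : 0 < γ) (v : Fin N → ℝ) (b : E) :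
    hilbertRidgeCost ψ γ v (hilbertRidgeSolution ψ γ v) ≤ hilbertRidgeCost ψ γ v b := by
  rw [hilbertRidgeCost_eq ψ hγ v b, add_assoc]
  exact le_add_of_nonneg_right (by positivity)

lemma eq_hilbertRidgeSolution (ψ : Fin N → E) {γ : ℝ} (hγ : 0 < γ) (v : Fin N → ℝ) {b : E}
    (hb : hilbertRidgeCost ψ γ v b ≤ hilbertRidgeCost ψ γ v (hilbertRidgeSolution ψ γ v)) :
    b = hilbertRidgeSolution ψ γ v := by
  rw [hilbertRidgeCost_eq ψ hγ v b, add_assoc] at hb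
  have hs : 0 ≤ ∑ i, (inner ℝ (ψ i) (b - hilbertRidgeSolution ψ γ v)) ^ 2 := by positivity
  have hn : γ * ‖b - hilbertRidgeSolution ψ γ v‖ ^ 2 ≤ 0 := by linarith
  have h0 : ‖b - hilbertRidgeSolution ψ γ v‖ ^ 2 ≤ 0 := nonpos_of_mul_nonpos_right hn hγ
  exact sub_eq_zero.1 (norm_eq_zero.1 (pow_eq_zero_iff two_ne_zero |>.1
    (le_antisymm h0 (sq_nonneg _))))

end Ridge

/-! ### The `ℓ²` feature map and the problem over coefficient sequences. -/

section Feature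

variable {α : ℝ}

lemma memℓp_two_iff_summable_sq {f : ℕ+ → ℝ} :
    Memℓp f 2 ↔ Summable fun j => f j ^ 2 := by
  rw [memℓp_gen_iff (by norm_num)]
  simp

/-- The feature map of the stable spline kernel with values in `ℓ²`. -/
noncomputable def splineFeature (hα0 : 0 ≤ α) (hα1 : α < 1) (t : ℕ+) : lp (fun _ : ℕ+ => ℝ) 2 :=
  ⟨fun j => Real.sqrt (zeta j) * rho α j t, memℓp_two_iff_summable_sq.2 <| by
    convert! (hasSum_stableSpline hα0 hα1 t t).summable using 2 with j
    rw [mul_pow, Real.sq_sqrt (zeta_pos j).le]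
    ring⟩

lemma splineFeature_apply (hα0 : 0 ≤ α) (hα1 : α < 1) (t j : ℕ+) :
    splineFeature hα0 hα1 t j = Real.sqrt (zeta j) * rho α j t := rfl

lemma inner_splineFeature (hα0 : 0 ≤ α) (hα1 : α < 1) (s t : ℕ+) :
    inner ℝ (splineFeature hα0 hα1 s) (splineFeature hα0 hα1 t) = 1 * stableSpline α s t := by
  rw [one_mul]
  refine (lp.hasSum_inner _ _).unique ?_
  convert! hasSum_stableSpline hα0 hα1 s t using 2 with j
  rw [splineFeature_apply, splineFeature_apply, Real.inner_apply]
  linear_combination rho α j s * rho α j t * Real.mul_self_sqrt (zeta_pos j).le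

variable {u : ℤ → ℝ} {n : ℤ}

/-- The representer in `ℓ²` of the output at the instant `n`. -/
noncomputable def outputFeature (hα0 : 0 ≤ α) (hα1 : α < 1) (u : ℤ → ℝ) (n : ℤ) :
    lp (fun _ : ℕ+ => ℝ) 2 :=
  ∑' k : ℕ+, u (n - (k : ℤ)) • splineFeature hα0 hα1 k

lemma hasSum_outputFeature_apply (hα0 : 0 ≤ α) (hα1 : α < 1)
    (hw : Summable fun k : ℕ+ => |u (n - (k : ℤ))| * Real.sqrt (α ^ (k : ℕ))) (j : ℕ+) :
    HasSum (fun k : ℕ+ => rho α j k * u (n - (k : ℤ)))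
      ((Real.sqrt (zeta j))⁻¹ * outputFeature hα0 hα1 u n j) := by
  -- Pairing with the j-th unit vector reads off the j-th coordinate of the series.
  have h := hasSum_inner_of_gram zero_le_one (inner_splineFeature hα0 hα1) hw
    (lp.single 2 j (1 : ℝ))
  simp only [lp.inner_single_left, splineFeature_apply, Real.inner_apply, one_mul] at h
  convert! h.mul_left (Real.sqrt (zeta j))⁻¹ using 2 with k
  field_simp [(sqrt_zeta_pos j).ne']

lemma convSummable_rho (hα0 : 0 ≤ α) (hα1 : α < 1)
    (hw : Summable fun k : ℕ+ => |u (n - (k : ℤ))| * Real.sqrt (α ^ (k : ℕ))) (j : ℕ+) :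
    ConvSummable (rho α j) u n :=
  (hasSum_outputFeature_apply hα0 hα1 hw j).summable

lemma outputFeature_apply (hα0 : 0 ≤ α) (hα1 : α < 1)
    (hw : Summable fun k : ℕ+ => |u (n - (k : ℤ))| * Real.sqrt (α ^ (k : ℕ))) (j : ℕ+) :
    outputFeature hα0 hα1 u n j = Real.sqrt (zeta j) * conv (rho α j) u n := by
  rw [conv, (hasSum_outputFeature_apply hα0 hα1 hw j).tsum_eq,
    mul_inv_cancel_left₀ (sqrt_zeta_pos j).ne']

lemma hasSum_conv_stableSpline (hα0 : 0 ≤ α) (hα1 : α < 1)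
    (hw : Summable fun k : ℕ+ => |u (n - (k : ℤ))| * Real.sqrt (α ^ (k : ℕ))) (t : ℕ+) :
    HasSum (fun k : ℕ+ => stableSpline α k t * u (n - (k : ℤ)))
      (inner ℝ (splineFeature hα0 hα1 t) (outputFeature hα0 hα1 u n)) := by
  convert! hasSum_stableSpline_of_gram zero_le_one (inner_splineFeature hα0 hα1) hw t using 2
    with k
  rw [stableSpline_comm]
  ring

lemma conv_stableSpline (hα0 : 0 ≤ α) (hα1 : α < 1)
    (hw : Summable fun k : ℕ+ => |u (n - (k : ℤ))| * Real.sqrt (α ^ (k : ℕ))) (t : ℕ+) :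
    conv (fun k => stableSpline α k t) u n =
      inner ℝ (splineFeature hα0 hα1 t) (outputFeature hα0 hα1 u n) :=
  (hasSum_conv_stableSpline hα0 hα1 hw t).tsum_eq

variable {N : ℕ} {τ : Fin N → ℤ}

lemma tsum_mul_stableSpline (hα0 : 0 ≤ α) (hα1 : α < 1)
    (hw : Summable fun k : ℕ+ => |u (n - (k : ℤ))| * Real.sqrt (α ^ (k : ℕ))) (t : ℕ+) :
    ∑' k : ℕ+, u (n - (k : ℤ)) * stableSpline α t k =
      inner ℝ (splineFeature hα0 hα1 t) (outputFeature hα0 hα1 u n) := by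
  have h := hasSum_stableSpline_of_gram zero_le_one (inner_splineFeature hα0 hα1) hw t
  simp only [one_mul] at h
  exact h.tsum_eq

lemma hasSum_outputKernel (hα0 : 0 ≤ α) (hα1 : α < 1)
    (hw : ∀ i, Summable fun k : ℕ+ => |u (τ i - (k : ℤ))| * Real.sqrt (α ^ (k : ℕ)))
    (i j : Fin N) :
    HasSum (fun t : ℕ+ => u (τ j - (t : ℤ)) * ∑' k : ℕ+, u (τ i - (k : ℤ)) * stableSpline α t k)
      (inner ℝ (outputFeature hα0 hα1 u (τ i)) (outputFeature hα0 hα1 u (τ j))) := by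
  convert! hasSum_inner_of_gram zero_le_one (inner_splineFeature hα0 hα1) (hw j)
    (outputFeature hα0 hα1 u (τ i)) using 3 with t
  rw [tsum_mul_stableSpline hα0 hα1 (hw i), real_inner_comm]

lemma outputKernel_eq_gram (hα0 : 0 ≤ α) (hα1 : α < 1)
    (hw : ∀ i, Summable fun k : ℕ+ => |u (τ i - (k : ℤ))| * Real.sqrt (α ^ (k : ℕ))) :
    outputKernel α u τ = Matrix.gram ℝ fun i => outputFeature hα0 hα1 u (τ i) := by
  ext i j
  exact (hasSum_outputKernel hα0 hα1 hw i j).tsum_eq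

/-- The coefficients of the atomic expansion attached to an element of `ℓ²`. -/
noncomputable def atomCoeff (b : lp (fun _ : ℕ+ => ℝ) 2) (j : ℕ+) : ℝ := Real.sqrt (zeta j) * b j

lemma sq_atomCoeff_div (b : lp (fun _ : ℕ+ => ℝ) 2) (j : ℕ+) :
    atomCoeff b j ^ 2 / zeta j = b j ^ 2 := by
  rw [atomCoeff, mul_pow, Real.sq_sqrt (zeta_pos j).le, mul_div_cancel_left₀ _ (zeta_pos j).ne']

lemma hasSum_sq_atomCoeff_div (b : lp (fun _ : ℕ+ => ℝ) 2) :
    HasSum (fun j => atomCoeff b j ^ 2 / zeta j) (‖b‖ ^ 2) := by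
  have h := lp.hasSum_inner (𝕜 := ℝ) b b
  rw [real_inner_self_eq_norm_sq] at h
  convert! h using 2 with j
  rw [sq_atomCoeff_div, Real.inner_apply]
  ring

lemma exists_atomCoeff_eq {a : ℕ+ → ℝ} (ha : Summable fun j => a j ^ 2 / zeta j) :
    ∃ b, atomCoeff b = a := by
  refine ⟨⟨fun j => a j / Real.sqrt (zeta j), memℓp_two_iff_summable_sq.2 ?_⟩, ?_⟩
  · simpa only [div_pow, Real.sq_sqrt (zeta_pos _).le] using ha
  · funext j
    exact mul_div_cancel₀ _ (sqrt_zeta_pos j).ne'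

lemma hasSum_atomCoeff_mul_rho (hα0 : 0 ≤ α) (hα1 : α < 1) (b : lp (fun _ : ℕ+ => ℝ) 2)
    (t : ℕ+) :
    HasSum (fun j => atomCoeff b j * rho α j t) (inner ℝ (splineFeature hα0 hα1 t) b) := by
  convert! lp.hasSum_inner (𝕜 := ℝ) (splineFeature hα0 hα1 t) b using 2 with j
  rw [splineFeature_apply, atomCoeff, Real.inner_apply]
  ring

lemma hasSum_atomOutput_mul_atomCoeff (hα0 : 0 ≤ α) (hα1 : α < 1)
    (hw : ∀ i, Summable fun k : ℕ+ => |u (τ i - (k : ℤ))| * Real.sqrt (α ^ (k : ℕ)))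
    (b : lp (fun _ : ℕ+ => ℝ) 2) (i : Fin N) :
    HasSum (fun j => atomOutput α u τ i j * atomCoeff b j)
      (inner ℝ (outputFeature hα0 hα1 u (τ i)) b) := by
  convert! lp.hasSum_inner (𝕜 := ℝ) (outputFeature hα0 hα1 u (τ i)) b using 2 with j
  rw [outputFeature_apply hα0 hα1 (hw i), atomCoeff, Real.inner_apply, atomOutput]
  ring

/-- The rescaling by `√ζ_j` makes the penalty the squared `ℓ²` norm and the predicted outputs inner
products with the representers. -/
lemma ridgeObjective_atomCoeff (hα0 : 0 ≤ α) (hα1 : α < 1)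
    (hw : ∀ i, Summable fun k : ℕ+ => |u (τ i - (k : ℤ))| * Real.sqrt (α ^ (k : ℕ)))
    {γ : ℝ} (hγ : 0 < γ) (v : Fin N → ℝ) (b : lp (fun _ : ℕ+ => ℝ) 2) :
    ridgeObjective α γ u τ v (atomCoeff b) =
      ENNReal.ofReal (hilbertRidgeCost (fun i => outputFeature hα0 hα1 u (τ i)) γ v b) := by
  have h := hasSum_sq_atomCoeff_div b
  have h0 (j : ℕ+) : 0 ≤ atomCoeff b j ^ 2 / zeta j := by
    rw [sq_atomCoeff_div]; positivity
  rw [ridgeObjective, ← ENNReal.ofReal_tsum_of_nonneg h0 h.summable, h.tsum_eq,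
    ← ENNReal.ofReal_mul hγ.le, ← ENNReal.ofReal_add (by positivity) (by positivity)]
  simp only [(hasSum_atomOutput_mul_atomCoeff hα0 hα1 hw b _).tsum_eq, hilbertRidgeCost]

lemma summable_of_ridgeObjective_ne_top {γ : ℝ} (hγ : 0 < γ) {v : Fin N → ℝ} {a : ℕ+ → ℝ}
    (ha : ridgeObjective α γ u τ v a ≠ ∞) : Summable fun j => a j ^ 2 / zeta j := by
  have h1 := (ENNReal.add_ne_top.1 ha).2
  have h2 : ∑' j : ℕ+, ENNReal.ofReal (a j ^ 2 / zeta j) ≠ ∞ := fun h => h1 <| by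
    rw [h, ENNReal.mul_top (by simpa using hγ)]
  convert! ENNReal.summable_toReal h2 using 2 with j
  rw [ENNReal.toReal_ofReal (div_nonneg (sq_nonneg _) (zeta_pos j).le)]

/-- Sequences of finite cost are exactly those of the form `atomCoeff b`, and a minimizer has finite
cost by comparison with such a sequence, so the Hilbert space result decides everything. -/
lemma isRidgeMinimizer_iff (hα0 : 0 ≤ α) (hα1 : α < 1)
    (hw : ∀ i, Summable fun k : ℕ+ => |u (τ i - (k : ℤ))| * Real.sqrt (α ^ (k : ℕ)))
    {γ : ℝ} (hγ : 0 < γ) (v : Fin N → ℝ) (a : ℕ+ → ℝ) :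
    IsRidgeMinimizer α γ u τ v a ↔
      a = atomCoeff (hilbertRidgeSolution (fun i => outputFeature hα0 hα1 u (τ i)) γ v) := by
  set ψ := fun i => outputFeature hα0 hα1 u (τ i)
  have hobj := ridgeObjective_atomCoeff hα0 hα1 hw hγ v
  constructor
  · intro ha
    have hle := ha (atomCoeff (hilbertRidgeSolution ψ γ v))
    rw [hobj] at hle
    obtain ⟨b, rfl⟩ := exists_atomCoeff_eq
      (summable_of_ridgeObjective_ne_top hγ (hle.trans_lt ENNReal.ofReal_lt_top).ne)
    rw [hobj, ENNReal.ofReal_le_ofReal_iff (hilbertRidgeCost_nonneg ψ hγ v _)] at hle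
    rw [eq_hilbertRidgeSolution ψ hγ v hle]
  · rintro rfl b
    by_cases hb : ridgeObjective α γ u τ v b = ∞
    · rw [hb]; exact le_top
    · obtain ⟨b, rfl⟩ := exists_atomCoeff_eq (summable_of_ridgeObjective_ne_top hγ hb)
      rw [hobj, hobj]
      exact ENNReal.ofReal_le_ofReal (hilbertRidgeCost_solution_le ψ hγ v b)

end Feature

/-! ### From almost sure to `L²` absolute convergence of Gaussian series. -/

lemma integral_abs_gaussianReal_pos : 0 < ∫ z, |z| ∂(gaussianReal 0 1) := by
  have hint : Integrable (fun z : ℝ => |z|) (gaussianReal 0 1) :=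
    (IsGaussian.hasGaussianLaw_id (μ := gaussianReal 0 1)).integrable.abs
  refine lt_of_le_of_ne (integral_nonneg fun z => abs_nonneg z) fun h => ?_
  have h0 : (fun z : ℝ => |z|) =ᵐ[gaussianReal 0 1] 0 :=
    (integral_eq_zero_iff_of_nonneg (fun z => abs_nonneg z) hint).1 h.symm
  have h1 : (fun z : ℝ => z) =ᵐ[gaussianReal 0 1] fun _ => 0 := by
    filter_upwards [h0] with z hz using abs_eq_zero.1 hz
  have h2 := variance_fun_id_gaussianReal (μ := 0) (v := 1)
  rw [variance_congr h1] at h2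
  rw [show (fun _ : ℝ => (0 : ℝ)) = 0 from rfl, variance_zero] at h2
  simp at h2

lemma integral_abs_of_hasLaw_gaussianReal {Ω : Type*} [MeasurableSpace Ω] {P : Measure Ω}
    {X : Ω → ℝ} {v : NNReal} (hX : HasLaw X (gaussianReal 0 v) P) :
    ∫ ω, |X ω| ∂P = Real.sqrt v * ∫ z, |z| ∂(gaussianReal 0 1) := by
  have hmap : (gaussianReal 0 1).map (fun z => Real.sqrt v * z) = gaussianReal 0 v := by
    rw [gaussianReal_map_const_mul]
    congr 1
    · simp
    · ext
      simp
  rw [← integral_map (f := fun x : ℝ => |x|) hX.aemeasurable (by fun_prop), hX.map_eq, ← hmap,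
    integral_map (by fun_prop) (by fun_prop), ← integral_const_mul]
  simp only [abs_mul, abs_of_nonneg (Real.sqrt_nonneg _)]

section Summability

variable {Ω : Type*} [MeasurableSpace Ω] {P : Measure Ω} [IsProbabilityMeasure P]

/-- Almost surely finite functions are bounded off sets of small probability. -/
lemma exists_nat_measure_lt_le {S : Ω → ℝ≥0∞} (hS : Measurable S) (hfin : ∀ᵐ ω ∂P, S ω < ∞)
    {δ : ℝ≥0∞} (hδ : 0 < δ) : ∃ M : ℕ, P {ω | (M : ℝ≥0∞) < S ω} ≤ δ := by
  have hlim : Filter.Tendsto (fun M : ℕ => P {ω | (M : ℝ≥0∞) < S ω}) Filter.atTop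
      (nhds (P (⋂ M : ℕ, {ω | (M : ℝ≥0∞) < S ω}))) := by
    refine tendsto_measure_iInter_atTop
      (fun M => (measurableSet_lt measurable_const hS).nullMeasurableSet) ?_
      ⟨0, measure_ne_top _ _⟩
    intro a b hab ω hω
    have hab' : (a : ℝ≥0∞) ≤ b := by exact_mod_cast hab
    exact hab'.trans_lt hω
  have hzero : P (⋂ M : ℕ, {ω | (M : ℝ≥0∞) < S ω}) = 0 := by
    refine measure_mono_null ?_ (ae_iff.1 hfin)
    intro ω hω hlt
    obtain ⟨n, hn⟩ := ENNReal.exists_nat_gt hlt.ne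
    exact lt_asymm hn (Set.mem_iInter.1 hω n)
  rw [hzero] at hlim
  exact (hlim.eventually_le_const hδ).exists

/-- The first absolute moment of a centered Gaussian variable is not concentrated on an event of
small probability. -/
lemma half_mul_sqrt_le_setIntegral_abs {X : Ω → ℝ} {v : NNReal}
    (hX : HasLaw X (gaussianReal 0 v) P) {B : Set Ω} (hB : MeasurableSet B)
    (hBc : P.real Bᶜ ≤ ((∫ z, |z| ∂(gaussianReal 0 1)) / 2) ^ 2) :
    (∫ z, |z| ∂(gaussianReal 0 1)) / 2 * Real.sqrt v ≤ ∫ ω in B, |X ω| ∂P := by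
  have hc := integral_abs_gaussianReal_pos
  set c := ∫ z, |z| ∂(gaussianReal 0 1) with hcdef
  -- The degenerate case is set apart because `√v` is cancelled at the end.
  rcases eq_or_lt_of_le (Real.sqrt_nonneg v) with hv | hv
  · rw [← hv, mul_zero]
    exact integral_nonneg fun ω => abs_nonneg _
  have hG : HasGaussianLaw X P := hX.hasGaussianLaw
  have hint : Integrable (fun ω => |X ω|) P := hG.integrable.abs
  have hsq : Integrable (fun ω => X ω ^ 2) P := hG.memLp_two.integrable_sq
  have hmean : ∫ ω, X ω ∂P = 0 := by rw [hX.integral_eq, integral_id_gaussianReal]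
  have hsqv : ∫ ω, X ω ^ 2 ∂P = v := by
    have h := hX.variance_eq
    rwa [variance_of_integral_eq_zero hX.aemeasurable hmean, variance_id_gaussianReal] at h
  have hsplit := integral_add_compl hB hint
  rw [integral_abs_of_hasLaw_gaussianReal hX, ← hcdef] at hsplit
  have hvv : Real.sqrt v * Real.sqrt v = v := Real.mul_self_sqrt v.2
  -- Weighted AM-GM: `c √v |X| ≤ (c/2)² X² + v`. Over `Bᶜ` each term on the right integrates to at
  -- most `(c/2)² v`, so `Bᶜ` carries at most half of the total moment `c √v`.
  have hpt : ∫ ω in Bᶜ, 2 * (c / 2) * Real.sqrt v * |X ω| ∂P ≤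
      ∫ ω in Bᶜ, ((c / 2) ^ 2 * X ω ^ 2 + v) ∂P := by
    refine integral_mono (hint.integrableOn.const_mul _)
      ((hsq.integrableOn.const_mul _).add (integrable_const _)) fun ω => ?_
    have h := sq_nonneg (c / 2 * |X ω| - Real.sqrt v)
    have h2 : (c / 2 * |X ω| - Real.sqrt v) ^ 2 =
        (c / 2) ^ 2 * X ω ^ 2 + v - 2 * (c / 2) * Real.sqrt v * |X ω| := by
      rw [← sq_abs (X ω)]
      linear_combination hvv
    simp only
    linarith
  rw [integral_const_mul, integral_add (hsq.integrableOn.const_mul _) (integrable_const _),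
    integral_const_mul, setIntegral_const, smul_eq_mul] at hpt
  have hle : ∫ ω in Bᶜ, X ω ^ 2 ∂P ≤ v := by
    rw [← hsqv]
    exact setIntegral_le_integral hsq (Filter.Eventually.of_forall fun ω => sq_nonneg _)
  have h1 : (c / 2) ^ 2 * ∫ ω in Bᶜ, X ω ^ 2 ∂P ≤ (c / 2) ^ 2 * v := by gcongr
  have h2 : P.real Bᶜ * v ≤ (c / 2) ^ 2 * v := by gcongr
  have h3 : c * Real.sqrt v * ∫ ω in Bᶜ, |X ω| ∂P ≤ c * Real.sqrt v * (c / 2 * Real.sqrt v) := by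
    calc c * Real.sqrt v * ∫ ω in Bᶜ, |X ω| ∂P
        = 2 * (c / 2) * Real.sqrt v * ∫ ω in Bᶜ, |X ω| ∂P := by ring
      _ ≤ (c / 2) ^ 2 * v + (c / 2) ^ 2 * v := by linarith
      _ = c * Real.sqrt v * (c / 2 * Real.sqrt v) := by linear_combination - c ^ 2 / 2 * hvv
  have h4 := le_of_mul_le_mul_left h3 (by positivity)
  linarith

/-- An almost surely absolutely convergent series of centered Gaussian variables is absolutely
convergent in `L²`. -/
lemma summable_abs_mul_sqrt_of_ae_summable {ι : Type*} [Countable ι] {X : ι → Ω → ℝ}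
    {v : ι → NNReal} (hmeas : ∀ k, Measurable (X k))
    (hX : ∀ k, HasLaw (X k) (gaussianReal 0 (v k)) P) {w : ι → ℝ}
    (hsum : ∀ᵐ ω ∂P, Summable fun k => X k ω * w k) :
    Summable fun k => |w k| * Real.sqrt (v k) := by
  have hc := integral_abs_gaussianReal_pos
  set c := ∫ z, |z| ∂(gaussianReal 0 1) with hcdef
  let S : Ω → ℝ≥0∞ := fun ω => ∑' k, ENNReal.ofReal |X k ω * w k|
  have hterm (k : ι) : Measurable fun ω => ENNReal.ofReal |X k ω * w k| := by
    have := hmeas k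
    fun_prop
  have hS : Measurable S := Measurable.tsum hterm
  have hfin : ∀ᵐ ω ∂P, S ω < ∞ := by
    filter_upwards [hsum] with ω hω
    exact lt_of_le_of_ne le_top hω.abs.tsum_ofReal_ne_top
  -- On `B = {S ≤ M}` the expected sum is at most `M`, while each term still keeps half of its first
  -- absolute moment; no independence of the terms is needed.
  obtain ⟨M, hM⟩ := exists_nat_measure_lt_le hS hfin
    (δ := ENNReal.ofReal ((c / 2) ^ 2)) (by rw [ENNReal.ofReal_pos]; positivity)
  set B : Set Ω := {ω | S ω ≤ M} with hBdef
  have hB : MeasurableSet B := measurableSet_le hS measurable_const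
  have hBc : P.real Bᶜ ≤ (c / 2) ^ 2 := by
    refine ENNReal.toReal_le_of_le_ofReal (by positivity) ?_
    convert! hM using 2
    ext ω
    simp [hBdef]
  have hlow (k : ι) : ENNReal.ofReal (c / 2 * (|w k| * Real.sqrt (v k))) ≤
      ∫⁻ ω in B, ENNReal.ofReal |X k ω * w k| ∂P := by
    have hint : Integrable (fun ω => |X k ω * w k|) P :=
      ((hX k).hasGaussianLaw.integrable.mul_const _).abs
    rw [← ofReal_integral_eq_lintegral_ofReal hint.integrableOn
      (Filter.Eventually.of_forall fun ω => abs_nonneg _)]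
    refine ENNReal.ofReal_le_ofReal ?_
    simp only [abs_mul, integral_mul_const]
    have h := mul_le_mul_of_nonneg_right (half_mul_sqrt_le_setIntegral_abs (hX k) hB hBc)
      (abs_nonneg (w k))
    calc c / 2 * (|w k| * Real.sqrt (v k)) = c / 2 * Real.sqrt (v k) * |w k| := by ring
      _ ≤ _ := h
  have htot : ∑' k, ENNReal.ofReal (c / 2 * (|w k| * Real.sqrt (v k))) ≠ ∞ := by
    refine ne_top_of_le_ne_top (ENNReal.natCast_ne_top M) ?_
    calc ∑' k, ENNReal.ofReal (c / 2 * (|w k| * Real.sqrt (v k)))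
        ≤ ∑' k, ∫⁻ ω in B, ENNReal.ofReal |X k ω * w k| ∂P := ENNReal.tsum_le_tsum hlow
      _ = ∫⁻ ω in B, S ω ∂P := (lintegral_tsum fun k => (hterm k).aemeasurable).symm
      _ ≤ ∫⁻ _ in B, (M : ℝ≥0∞) ∂P := setLIntegral_mono measurable_const fun ω hω => hω
      _ ≤ M := by
        rw [setLIntegral_const]
        exact mul_le_of_le_one_right' prob_le_one
  have h := ENNReal.summable_toReal htot
  rw [← summable_mul_left_iff (show c / 2 ≠ 0 by positivity)]
  convert! h using 2 with k
  rw [ENNReal.toReal_ofReal (by positivity)]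

end Summability

/-! ### Gaussian subspaces of `L²` and conditional expectation as projection. -/

section GaussianSpace

variable {Ω : Type*} [MeasurableSpace Ω] {P : Measure Ω} [IsProbabilityMeasure P]

lemma inner_one_eq_integral (f : Lp ℝ 2 P) :
    inner ℝ (indicatorConstLp 2 MeasurableSet.univ (measure_ne_top P Set.univ) (1 : ℝ)) f =
      ∫ ω, f ω ∂P := by
  rw [L2.inner_indicatorConstLp_one, setIntegral_univ]

lemma continuous_integral_Lp_two : Continuous fun f : Lp ℝ 2 P => ∫ ω, f ω ∂P := by
  simp only [← inner_one_eq_integral]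
  fun_prop

omit [IsProbabilityMeasure P] in
lemma integral_mul_eq_inner (f h : Lp ℝ 2 P) : ∫ ω, f ω * h ω ∂P = inner ℝ f h := by
  rw [L2.inner_def]
  refine integral_congr_ae (Filter.Eventually.of_forall fun ω => ?_)
  simp [mul_comm]

lemma variance_Lp_two (f : Lp ℝ 2 P) :
    Var[f; P] = inner ℝ f f - (∫ ω, f ω ∂P) ^ 2 := by
  rw [variance_eq_sub (Lp.memLp f), ← integral_mul_eq_inner]
  simp [pow_two]

lemma continuous_variance_Lp_two : Continuous fun f : Lp ℝ 2 P => Var[f; P] := by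
  simp only [variance_Lp_two]
  have := continuous_integral_Lp_two (P := P)
  fun_prop

omit [IsProbabilityMeasure P] in
lemma coeFn_sum_smul_ae_eq {T : Type*} {Z : T → Lp ℝ 2 P} {X : T → Ω → ℝ}
    (hZ : ∀ t, Z t =ᵐ[P] X t) (c : T → ℝ) (s : Finset T) :
    (∑ i ∈ s, c i • Z i : Lp ℝ 2 P) =ᵐ[P] fun ω => ∑ i ∈ s, c i * X i ω := by
  induction s using Finset.cons_induction with
  | empty =>
    simp only [Finset.sum_empty]
    exact Lp.coeFn_zero ℝ 2 P
  | cons a s ha ih =>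
    simp only [Finset.sum_cons]
    filter_upwards [Lp.coeFn_add (c a • Z a) (∑ i ∈ s, c i • Z i), Lp.coeFn_smul (c a) (Z a),
      hZ a, ih] with ω h1 h2 h3 h4
    rw [h1, Pi.add_apply, h2, Pi.smul_apply, h3, h4, smul_eq_mul]

/-- Limits in `L²` of Gaussian variables are Gaussian. -/
lemma isClosed_setOf_hasGaussianLaw : IsClosed {f : Lp ℝ 2 P | HasGaussianLaw f P} := by
  refine IsSeqClosed.isClosed fun f g hf hfg => ?_
  have hmeas (n : ℕ) : AEMeasurable (f n) P := (Lp.aestronglyMeasurable _).aemeasurable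
  have hg : AEMeasurable g P := (Lp.aestronglyMeasurable _).aemeasurable
  -- `L²` convergence gives convergence of characteristic functions, means and variances, so the
  -- limit has the characteristic function of a Gaussian law.
  have hdist := ((tendstoInMeasure_of_tendsto_Lp hfg).tendstoInDistribution hmeas).tendsto
  have hchar := ProbabilityMeasure.tendsto_iff_tendsto_charFun.1 hdist
  have hmean := (continuous_integral_Lp_two (P := P)).tendsto g |>.comp hfg
  have hvar := (continuous_real_toNNReal.comp (continuous_variance_Lp_two (P := P))).tendsto g
    |>.comp hfg
  have hlaw : P.map g = gaussianReal (∫ ω, g ω ∂P) Var[g; P].toNNReal := by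
    have := Measure.isProbabilityMeasure_map (μ := P) hg
    refine Measure.ext_of_charFun (funext fun t => ?_)
    refine tendsto_nhds_unique (hchar t) ?_
    rw [charFun_gaussianReal]
    have heq (n : ℕ) : charFun (P.map (f n)) t =
        Complex.exp (t * (∫ ω, f n ω ∂P : ℝ) * Complex.I -
          (Var[f n; P].toNNReal : ℝ) * t ^ 2 / 2) := by
      rw [HasGaussianLaw.map_eq_gaussianReal (hf n), charFun_gaussianReal]
    simp only [ProbabilityMeasure.coe_mk, heq]
    have hm : Filter.Tendsto (fun n => ((∫ ω, f n ω ∂P : ℝ) : ℂ)) Filter.atTop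
        (nhds ((∫ ω, g ω ∂P : ℝ) : ℂ)) := (Complex.continuous_ofReal.tendsto _).comp hmean
    have hv : Filter.Tendsto (fun n => (((Var[f n; P].toNNReal : NNReal) : ℝ) : ℂ)) Filter.atTop
        (nhds (((Var[g; P].toNNReal : NNReal) : ℝ) : ℂ)) :=
      ((Complex.continuous_ofReal.comp NNReal.continuous_coe).tendsto _).comp hvar
    refine (Complex.continuous_exp.tendsto _).comp ?_
    exact ((hm.const_mul _).mul_const _).sub ((hv.mul_const _).div_const _)
  refine ⟨?_⟩
  rw [hlaw]
  infer_instance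

/-- The closed linear span in `L²` of a Gaussian process consists of Gaussian variables. -/
lemma hasGaussianLaw_of_mem_closure_span {T : Type*} {X : T → Ω → ℝ}
    (hX : IsGaussianProcess X P) {Z : T → Lp ℝ 2 P} (hZ : ∀ t, Z t =ᵐ[P] X t) {f : Lp ℝ 2 P}
    (hf : f ∈ (Submodule.span ℝ (Set.range Z)).topologicalClosure) : HasGaussianLaw f P := by
  refine closure_minimal (s := (Submodule.span ℝ (Set.range Z) : Set (Lp ℝ 2 P))) ?_
    (isClosed_setOf_hasGaussianLaw (P := P)) ?_
  swap
  · rw [← Submodule.topologicalClosure_coe]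
    exact hf
  intro h hh
  obtain ⟨c, rfl⟩ := Finsupp.mem_span_range_iff_exists_finsupp.1 hh
  refine (((hX.smul c).hasGaussianLaw_fun_sum (I := c.support))).congr ?_
  exact (coeFn_sum_smul_ae_eq hZ c c.support).symm

/-- The mean is the inner product with the constant `1`, so centered variables form a closed
subspace. -/
lemma integral_eq_zero_of_mem_closure_span {T : Type*} {Z : T → Lp ℝ 2 P}
    (hZ : ∀ t, ∫ ω, Z t ω ∂P = 0) {f : Lp ℝ 2 P}
    (hf : f ∈ (Submodule.span ℝ (Set.range Z)).topologicalClosure) : ∫ ω, f ω ∂P = 0 := by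
  rw [← inner_one_eq_integral]
  set one := indicatorConstLp 2 MeasurableSet.univ (measure_ne_top P Set.univ) (1 : ℝ)
  have hle : (Submodule.span ℝ (Set.range Z)).topologicalClosure ≤
      (innerSL ℝ one).ker := by
    refine Submodule.topologicalClosure_minimal _ ?_ (innerSL ℝ one).isClosed_ker
    rw [Submodule.span_le]
    rintro _ ⟨t, rfl⟩
    exact (inner_one_eq_integral (Z t)).trans (hZ t)
  exact hle hf

omit [IsProbabilityMeasure P] in
/-- If all coordinates of a finite dimensional vector lie in a linear space of Gaussian variables,
the vector is Gaussian. -/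
lemma hasGaussianLaw_prodMk_pi {V : Submodule ℝ (Lp ℝ 2 P)} (hV : ∀ f ∈ V, HasGaussianLaw f P)
    {N : ℕ} {D : Ω → ℝ} {y : Fin N → Ω → ℝ} (hD : Measurable D) (hy : ∀ i, Measurable (y i))
    {D' : Lp ℝ 2 P} {Y : Fin N → Lp ℝ 2 P} (hD' : D' ∈ V) (hY : ∀ i, Y i ∈ V)
    (hDD' : D' =ᵐ[P] D) (hyY : ∀ i, Y i =ᵐ[P] y i) :
    HasGaussianLaw (fun ω => (D ω, fun i => y i ω)) P := by
  have hmeas : Measurable fun ω => (D ω, fun i => y i ω) :=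
    hD.prodMk (measurable_pi_lambda _ hy)
  refine ⟨isGaussian_of_isGaussian_map fun L => ?_⟩
  rw [Measure.map_map (by fun_prop) hmeas]
  have hL (d : ℝ) (z : Fin N → ℝ) :
      L (d, z) = L (1, 0) * d + ∑ i, L (0, Pi.single i 1) * z i := by
    have h1 : ((d, z) : ℝ × (Fin N → ℝ)) =
        d • ((1, 0) : ℝ × (Fin N → ℝ)) + ∑ i, z i • ((0, Pi.single i 1) : ℝ × (Fin N → ℝ)) := by
      refine Prod.ext ?_ ?_
      · simp [Prod.fst_sum]
      · simp only [Prod.snd_add, Prod.smul_snd, smul_zero, zero_add, Prod.snd_sum]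
        exact pi_eq_sum_univ' z
    rw [h1, map_add, map_smul, map_sum]
    simp only [map_smul, smul_eq_mul, mul_comm]
  have hmem : L (1, 0) • D' + ∑ i, L (0, Pi.single i 1) • Y i ∈ V :=
    V.add_mem (V.smul_mem _ hD') (V.sum_mem fun i _ => V.smul_mem _ (hY i))
  refine ((hV _ hmem).congr ?_).isGaussian_map
  filter_upwards [Lp.coeFn_add (L (1, 0) • D') (∑ i, L (0, Pi.single i 1) • Y i),
    Lp.coeFn_smul (L (1, 0)) D', hDD',
    coeFn_sum_smul_ae_eq hyY (fun i => L (0, Pi.single i 1)) Finset.univ] with ω h1 h2 h3 h4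
  rw [h1, Pi.add_apply, h2, Pi.smul_apply, h3, h4, Function.comp_apply, hL (D ω), smul_eq_mul]

/-- In a linear space of centered Gaussian variables, the conditional expectation is the
orthogonal projection. -/
lemma condExp_eq_sum_of_orthogonal {V : Submodule ℝ (Lp ℝ 2 P)}
    (hV : ∀ f ∈ V, HasGaussianLaw f P) (hV0 : ∀ f ∈ V, ∫ ω, f ω ∂P = 0)
    {N : ℕ} {x : Ω → ℝ} {y : Fin N → Ω → ℝ} (hx : Measurable x) (hy : ∀ i, Measurable (y i))
    {X : Lp ℝ 2 P} {Y : Fin N → Lp ℝ 2 P} (hX : X ∈ V) (hY : ∀ i, Y i ∈ V)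
    (hxX : X =ᵐ[P] x) (hyY : ∀ i, Y i =ᵐ[P] y i) {c : Fin N → ℝ}
    (horth : ∀ j, inner ℝ X (Y j) = ∑ i, c i * inner ℝ (Y i) (Y j)) :
    P[x | MeasurableSpace.comap (fun ω i => y i ω) inferInstance] =ᵐ[P]
      fun ω => ∑ i, c i * y i ω := by
  have hymeas : Measurable fun ω i => y i ω := measurable_pi_lambda _ hy
  let s : Ω → ℝ := fun ω => ∑ i, c i * y i ω
  have hs_meas : Measurable[MeasurableSpace.comap (fun ω i => y i ω) inferInstance] s := by
    have h : Measurable fun z : Fin N → ℝ => ∑ i, c i * z i := by fun_prop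
    exact h.comp (comap_measurable fun ω i => y i ω)
  let D : Ω → ℝ := x - s
  have hD : Measurable D := hx.sub (hs_meas.mono hymeas.comap_le le_rfl)
  set D' : Lp ℝ 2 P := X - ∑ i, c i • Y i with hD'
  have hD'V : D' ∈ V := V.sub_mem hX (V.sum_mem fun i _ => V.smul_mem _ (hY i))
  have hDD' : D' =ᵐ[P] D := by
    filter_upwards [Lp.coeFn_sub X (∑ i, c i • Y i), hxX,
      coeFn_sum_smul_ae_eq hyY c Finset.univ] with ω h1 h2 h3
    rw [hD', h1, Pi.sub_apply, h2, h3]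
    rfl
  have hgauss := hasGaussianLaw_prodMk_pi hV hD hy hD'V hY hDD' hyY
  have hDint : Integrable D P := ((hV _ hD'V).congr hDD').integrable
  have hsint : Integrable s P := by
    refine integrable_finsetSum _ fun i _ => ?_
    exact ((hV _ (hY i)).congr (hyY i)).integrable.const_mul _
  have hDmean : ∫ ω, D ω ∂P = 0 := by
    rw [← integral_congr_ae hDD']
    exact hV0 _ hD'V
  -- `horth` says that the residual `D` is orthogonal to every observation; both being jointly
  -- Gaussian, uncorrelated will mean independent.
  have hcov (j : Fin N) : cov[D, y j; P] = 0 := by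
    rw [covariance_eq_sub ((hV _ hD'V).congr hDD').memLp_two
      ((hV _ (hY j)).congr (hyY j)).memLp_two, hDmean, zero_mul, sub_zero]
    have h1 : ∫ ω, D' ω * Y j ω ∂P = 0 := by
      rw [integral_mul_eq_inner, hD', inner_sub_left, sum_inner, horth]
      simp [inner_smul_left]
    rw [← h1]
    refine integral_congr_ae ?_
    filter_upwards [hDD', hyY j] with ω h2 h3
    rw [Pi.mul_apply, h2, h3]
  have hindep : IndepFun D (fun ω i => y i ω) P := by
    have hpi : HasGaussianLaw (fun ω => (fun _ : Unit => D ω, fun i => y i ω)) P :=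
      hgauss.map_fun ((ContinuousLinearMap.pi fun _ : Unit => ContinuousLinearMap.fst ℝ _ _).prod
        (ContinuousLinearMap.snd ℝ _ _))
    have h := HasGaussianLaw.indepFun_of_covariance_eval (X := fun _ : Unit => D) hpi
      fun _ j => hcov j
    exact h.comp (measurable_pi_apply ()) measurable_id
  have hcD := condExp_indep_eq hD.comap_le hymeas.comap_le
    (comap_measurable D).stronglyMeasurable hindep
  have hcs := condExp_of_stronglyMeasurable hymeas.comap_le hs_meas.stronglyMeasurable hsint
  have hadd := condExp_add hDint hsint (MeasurableSpace.comap (fun ω i => y i ω) inferInstance)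
  rw [show D + s = x by simp [D]] at hadd
  filter_upwards [hadd, hcD] with ω h1 h2
  rw [h1, Pi.add_apply, h2, hDmean, hcs, zero_add]

omit [IsProbabilityMeasure P] in
/-- The pair of a Gaussian process and an independent Gaussian vector is a Gaussian process. -/
lemma isGaussianProcess_sumElim_of_indepFun {T : Type*} {N : ℕ} {X : T → Ω → ℝ}
    {e : Fin N → Ω → ℝ} (hX : IsGaussianProcess X P) (he : HasGaussianLaw (fun ω i => e i ω) P)
    (hXe : IndepFun (fun ω t => X t ω) (fun ω i => e i ω) P) :
    IsGaussianProcess (Sum.elim X e) P where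
  hasGaussianLaw I := by
    have hr : Measurable fun (z : T → ℝ) (t : I.toLeft) => z t :=
      measurable_pi_lambda _ fun t => measurable_pi_apply _
    have hpair := IndepFun.hasGaussianLaw (hX.hasGaussianLaw I.toLeft) he
      (hXe.comp hr measurable_id)
    let L : ((I.toLeft → ℝ) × (Fin N → ℝ)) →L[ℝ] (I → ℝ) :=
      ContinuousLinearMap.pi fun i => match i with
        | ⟨Sum.inl t, h⟩ => (ContinuousLinearMap.proj (R := ℝ) (φ := fun _ : I.toLeft => ℝ)
            ⟨t, Finset.mem_toLeft.2 h⟩).comp (ContinuousLinearMap.fst ℝ _ _)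
        | ⟨Sum.inr j, _⟩ => (ContinuousLinearMap.proj (R := ℝ) (φ := fun _ : Fin N => ℝ) j).comp
            (ContinuousLinearMap.snd ℝ _ _)
    convert! hpair.map_fun L using 1
    funext ω i
    rcases i with ⟨t | j, h⟩ <;> rfl

omit [IsProbabilityMeasure P] in
/-- A series which converges absolutely in `L²` and almost surely has the same sum in both
senses. -/
lemma tsum_smul_ae_eq {Z : ℕ+ → Lp ℝ 2 P} {X : ℕ+ → Ω → ℝ} (hZ : ∀ k, Z k =ᵐ[P] X k)
    {w : ℕ+ → ℝ} (hs : Summable fun k => w k • Z k)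
    (hae : ∀ᵐ ω ∂P, Summable fun k => X k ω * w k) :
    (∑' k, w k • Z k : Lp ℝ 2 P) =ᵐ[P] fun ω => ∑' k, X k ω * w k := by
  -- Some sequence of finite partial sums converges almost surely to the `L²` sum; pointwise
  -- summability forces the same limit.
  obtain ⟨ns, hns, hlim⟩ := (tendstoInMeasure_of_tendsto_Lp hs.hasSum).exists_seq_tendsto_ae'
  filter_upwards [hlim, hae, ae_all_iff.2 fun n => coeFn_sum_smul_ae_eq hZ w (ns n)] with ω h1 h2 h3
  refine tendsto_nhds_unique h1 ?_
  simp only [h3, mul_comm (w _)]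
  exact h2.hasSum.comp hns

end GaussianSpace

/-! ### The posterior mean of the impulse response. -/

section Posterior

variable {Ω : Type*} [MeasurableSpace Ω] {P : Measure Ω} [IsProbabilityMeasure P]

omit [IsProbabilityMeasure P] in
lemma hasLaw_of_gram_stableSpline {α lam : ℝ} {g : ℕ+ → Ω → ℝ} (hg_gauss : IsGaussianProcess g P)
    (hg_mean : ∀ t, ∫ ω, g t ω ∂P = 0)
    (hg_cov : ∀ s t, ∫ ω, g s ω * g t ω ∂P = lam * stableSpline α s t) (k : ℕ+) :
    HasLaw (g k) (gaussianReal 0 (lam * α ^ (k : ℕ)).toNNReal) P := by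
  have h := hg_gauss.hasGaussianLaw_eval k
  refine ⟨h.aemeasurable, ?_⟩
  have hvar : Var[g k; P] = lam * α ^ (k : ℕ) := by
    rw [variance_of_integral_eq_zero h.aemeasurable (hg_mean k)]
    simpa [pow_two, stableSpline] using hg_cov k k
  rw [h.map_eq_gaussianReal, hg_mean, hvar]

/-- If the convolution of the process with the input converges almost surely, then the input is
summable against the standard deviations of the process. -/
lemma summable_input_of_convSummable {α lam : ℝ} (hα0 : 0 ≤ α) (hlam : 0 < lam)
    {g : ℕ+ → Ω → ℝ} (hg_meas : ∀ t, Measurable (g t)) (hg_gauss : IsGaussianProcess g P)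
    (hg_mean : ∀ t, ∫ ω, g t ω ∂P = 0)
    (hg_cov : ∀ s t, ∫ ω, g s ω * g t ω ∂P = lam * stableSpline α s t) {u : ℤ → ℝ} {n : ℤ}
    (hconv : ∀ᵐ ω ∂P, ConvSummable (fun k => g k ω) u n) :
    Summable fun k : ℕ+ => |u (n - (k : ℤ))| * Real.sqrt (α ^ (k : ℕ)) := by
  have h := summable_abs_mul_sqrt_of_ae_summable hg_meas
    (hasLaw_of_gram_stableSpline hg_gauss hg_mean hg_cov) hconv
  rw [← summable_mul_left_iff (Real.sqrt_pos.2 hlam).ne']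
  convert! h using 2 with k
  rw [Real.coe_toNNReal _ (mul_nonneg hlam.le (pow_nonneg hα0 _)), Real.sqrt_mul hlam.le]
  ring

/-- Projection yields weights `M⁻¹ k` applied to the data, the representer formula weights `M⁻¹ v`
applied to the kernel sections; symmetry of `M` reconciles them. -/
lemma sum_inv_mulVec_mul {N : ℕ} {M : Matrix (Fin N) (Fin N) ℝ} (hM : M.transpose = M)
    (v k : Fin N → ℝ) :
    ∑ i, M⁻¹.mulVec v i * k i = ∑ i, M⁻¹.mulVec k i * v i := by
  have hinv : M⁻¹.transpose = M⁻¹ := by rw [Matrix.transpose_nonsing_inv, hM]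
  change M⁻¹.mulVec v ⬝ᵥ k = M⁻¹.mulVec k ⬝ᵥ v
  rw [dotProduct_comm, Matrix.dotProduct_mulVec, ← Matrix.mulVec_transpose, hinv]

/-- The posterior mean of the impulse response given the noisy outputs. -/
lemma condExp_eq_sum_gram_inv {α lam σ : ℝ} (hα0 : 0 ≤ α) (hα1 : α < 1) (hlam : 0 < lam)
    (hσ : 0 < σ) {u : ℤ → ℝ} {N : ℕ} {τ : Fin N → ℤ}
    {g : ℕ+ → Ω → ℝ} {e : Fin N → Ω → ℝ} {y : Fin N → Ω → ℝ}
    (hg_meas : ∀ t, Measurable (g t)) (he_meas : ∀ i, Measurable (e i))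
    (hy_meas : ∀ i, Measurable (y i)) (hg_gauss : IsGaussianProcess g P)
    (hg_mean : ∀ t, ∫ ω, g t ω ∂P = 0)
    (hg_cov : ∀ s t, ∫ ω, g s ω * g t ω ∂P = lam * stableSpline α s t)
    (he_law : ∀ i, HasLaw (e i) (gaussianReal 0 (Real.toNNReal (σ ^ 2))) P)
    (he_indep : iIndepFun e P)
    (hge : IndepFun (fun ω t => g t ω) (fun ω i => e i ω) P)
    (hconv : ∀ i, ∀ᵐ ω ∂P, ConvSummable (fun k => g k ω) u (τ i))
    (hy : ∀ i, ∀ᵐ ω ∂P, y i ω = conv (fun k => g k ω) u (τ i) + e i ω) (t : ℕ+) :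
    P[g t | MeasurableSpace.comap (fun ω i => y i ω) inferInstance] =ᵐ[P] fun ω =>
      ∑ i, (Matrix.gram ℝ (fun i => outputFeature hα0 hα1 u (τ i)) +
        (σ ^ 2 / lam) • (1 : Matrix (Fin N) (Fin N) ℝ))⁻¹.mulVec (fun i => y i ω) i *
        inner ℝ (splineFeature hα0 hα1 t) (outputFeature hα0 hα1 u (τ i)) := by
  have hw (i : Fin N) := summable_input_of_convSummable hα0 hlam hg_meas hg_gauss hg_mean hg_cov
    (hconv i)
  set φ := splineFeature hα0 hα1 with hφ
  set ψ := fun i => outputFeature hα0 hα1 u (τ i) with hψ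
  set γ := σ ^ 2 / lam with hγdef
  have hγ : 0 < γ := by positivity
  set M := Matrix.gram ℝ ψ + γ • (1 : Matrix (Fin N) (Fin N) ℝ) with hM
  set k : Fin N → ℝ := fun i => inner ℝ (φ t) (ψ i) with hk
  have hMsymm : M.transpose = M := by
    ext i j
    simp [hM, Matrix.gram_apply, real_inner_comm, Matrix.one_apply, eq_comm]
  have hMunit : IsUnit M := isUnit_gram_add_smul_one ψ hγ
  have hgG (s : ℕ+) : HasGaussianLaw (g s) P := hg_gauss.hasGaussianLaw_eval s
  have heG (i : Fin N) : HasGaussianLaw (e i) P := (he_law i).hasGaussianLaw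
  have he_mean (i : Fin N) : ∫ ω, e i ω ∂P = 0 := by
    rw [(he_law i).integral_eq, integral_id_gaussianReal]
  have he_sq (i : Fin N) : ∫ ω, e i ω * e i ω ∂P = σ ^ 2 := by
    have h := (he_law i).variance_eq
    rw [variance_of_integral_eq_zero (he_meas i).aemeasurable (he_mean i),
      variance_id_gaussianReal, Real.coe_toNNReal _ (sq_nonneg σ)] at h
    simpa [pow_two] using h
  let Zg : ℕ+ → Lp ℝ 2 P := fun s => (hgG s).memLp_two.toLp (g s)
  let Ze : Fin N → Lp ℝ 2 P := fun i => (heG i).memLp_two.toLp (e i)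
  have hZg (s : ℕ+) : Zg s =ᵐ[P] g s := MemLp.coeFn_toLp _
  have hZe (i : Fin N) : Ze i =ᵐ[P] e i := MemLp.coeFn_toLp _
  have hgg (s r : ℕ+) : inner ℝ (Zg s) (Zg r) = lam * stableSpline α s r := by
    rw [← integral_mul_eq_inner, ← hg_cov]
    refine integral_congr_ae ?_
    filter_upwards [hZg s, hZg r] with ω h1 h2
    rw [h1, h2]
  have hge0 (s : ℕ+) (j : Fin N) : inner ℝ (Ze j) (Zg s) = 0 := by
    have hind : IndepFun (g s) (e j) P :=
      hge.comp (measurable_pi_apply s) (measurable_pi_apply j)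
    rw [real_inner_comm, ← integral_mul_eq_inner]
    have h := hind.integral_fun_mul_eq_mul_integral (hg_meas s).aestronglyMeasurable
      (he_meas j).aestronglyMeasurable
    rw [hg_mean, zero_mul] at h
    rw [← h]
    refine integral_congr_ae ?_
    filter_upwards [hZg s, hZe j] with ω h1 h2
    rw [h1, h2]
  have hee (i j : Fin N) : inner ℝ (Ze i) (Ze j) = if i = j then σ ^ 2 else 0 := by
    rw [← integral_mul_eq_inner]
    have hcongr : ∫ ω, Ze i ω * Ze j ω ∂P = ∫ ω, e i ω * e j ω ∂P := by
      refine integral_congr_ae ?_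
      filter_upwards [hZe i, hZe j] with ω h1 h2
      rw [h1, h2]
    rw [hcongr]
    split_ifs with hij
    · rw [hij, he_sq]
    · have h := (he_indep.indepFun hij).integral_fun_mul_eq_mul_integral
        (he_meas i).aestronglyMeasurable (he_meas j).aestronglyMeasurable
      rw [h, he_mean, zero_mul]
  let G : Fin N → Lp ℝ 2 P := fun i => ∑' s : ℕ+, u (τ i - (s : ℤ)) • Zg s
  have hGs (i : Fin N) : Summable fun s : ℕ+ => u (τ i - (s : ℤ)) • Zg s :=
    (summable_norm_smul_of_gram hlam.le hgg (hw i)).of_norm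
  have hgGi (s : ℕ+) (i : Fin N) : inner ℝ (Zg s) (G i) = lam * inner ℝ (φ s) (ψ i) := by
    refine (hasSum_stableSpline_of_gram hlam.le hgg (hw i) s).unique ?_
    convert! (hasSum_stableSpline_of_gram zero_le_one (inner_splineFeature hα0 hα1)
      (hw i) s).mul_left lam using 2 with r
    ring
  have hGG (i j : Fin N) : inner ℝ (G i) (G j) = lam * inner ℝ (ψ i) (ψ j) := by
    refine (hasSum_inner_of_gram hlam.le hgg (hw j) (G i)).unique ?_
    convert! (hasSum_inner_of_gram zero_le_one (inner_splineFeature hα0 hα1)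
      (hw j) (ψ i)).mul_left lam using 2 with r
    rw [real_inner_comm, hgGi, real_inner_comm]
    ring
  have heGi (i j : Fin N) : inner ℝ (Ze i) (G j) = 0 := by
    refine (hasSum_inner_of_gram hlam.le hgg (hw j) (Ze i)).unique ?_
    simpa only [hge0, mul_zero] using hasSum_zero
  let Y : Fin N → Lp ℝ 2 P := fun i => G i + Ze i
  -- The choice `γ = σ² / lam` makes the data covariance `lam * M`; the factor `lam` then drops out
  -- of the normal equations.
  have hYY (i j : Fin N) : inner ℝ (Y i) (Y j) = lam * M i j := by
    simp only [Y, inner_add_left, inner_add_right, hGG, hee, heGi, real_inner_comm (Ze j) (G i),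
      hM, Matrix.add_apply, Matrix.gram_apply, Matrix.smul_apply, Matrix.one_apply, smul_eq_mul]
    have hcancel : lam * γ = σ ^ 2 := by rw [hγdef]; field_simp
    split_ifs
    · linear_combination - hcancel
    · ring
  have hXY (j : Fin N) : inner ℝ (Zg t) (Y j) = lam * k j := by
    simp only [Y, inner_add_right, hgGi, real_inner_comm (Ze j) (Zg t), hge0, add_zero, hk]
  have hGae (i : Fin N) : G i =ᵐ[P] fun ω => conv (fun s => g s ω) u (τ i) :=
    tsum_smul_ae_eq hZg (hGs i) (hconv i)
  have hYae (i : Fin N) : Y i =ᵐ[P] y i := by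
    filter_upwards [Lp.coeFn_add (G i) (Ze i), hGae i, hZe i, hy i] with ω h1 h2 h3 h4
    rw [h1, Pi.add_apply, h2, h3, h4]
  let Z : ℕ+ ⊕ Fin N → Lp ℝ 2 P := Sum.elim Zg Ze
  have hZ (s : ℕ+ ⊕ Fin N) : Z s =ᵐ[P] (Sum.elim g e : ℕ+ ⊕ Fin N → Ω → ℝ) s := by
    rcases s with s | j
    · exact hZg s
    · exact hZe j
  have hproc : IsGaussianProcess (Sum.elim g e) P :=
    isGaussianProcess_sumElim_of_indepFun hg_gauss (he_indep.hasGaussianLaw heG) hge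
  -- The closure is needed because the noiseless outputs `G i` are infinite series in the process.
  set V := (Submodule.span ℝ (Set.range Z)).topologicalClosure with hV
  have hVZ (s : ℕ+ ⊕ Fin N) : Z s ∈ V :=
    Submodule.le_topologicalClosure _ (Submodule.subset_span ⟨s, rfl⟩)
  have hVG (i : Fin N) : G i ∈ V :=
    (Submodule.isClosed_topologicalClosure _).mem_of_tendsto (hGs i).hasSum
      (Filter.Eventually.of_forall fun s => V.sum_mem fun r _ => V.smul_mem _ (hVZ (Sum.inl r)))
  have hVY (i : Fin N) : Y i ∈ V := V.add_mem (hVG i) (hVZ (Sum.inr i))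
  have hZ0 (s : ℕ+ ⊕ Fin N) : ∫ ω, Z s ω ∂P = 0 := by
    rw [integral_congr_ae (hZ s)]
    rcases s with s | j
    · exact hg_mean s
    · exact he_mean j
  have hMc : M.mulVec (M⁻¹.mulVec k) = k := by
    rw [Matrix.mulVec_mulVec, Matrix.mul_nonsing_inv, Matrix.one_mulVec]
    exact (Matrix.isUnit_iff_isUnit_det _).1 hMunit
  have horth (j : Fin N) :
      inner ℝ (Zg t) (Y j) = ∑ i, M⁻¹.mulVec k i * inner ℝ (Y i) (Y j) := by
    simp only [hXY, hYY]
    rw [← congrFun hMc j]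
    simp only [Matrix.mulVec, dotProduct, Finset.mul_sum]
    refine Finset.sum_congr rfl fun i _ => ?_
    have hij : M i j = M j i := congrFun (congrFun hMsymm j) i
    rw [hij, ← Finset.mul_sum]
    simp only [Finset.sum_mul, Finset.mul_sum]
    refine Finset.sum_congr rfl fun r _ => ?_
    ring
  have hmain := condExp_eq_sum_of_orthogonal
    (fun f hf => hasGaussianLaw_of_mem_closure_span hproc hZ hf)
    (fun f hf => integral_eq_zero_of_mem_closure_span hZ0 hf)
    (hg_meas t) hy_meas (hVZ (Sum.inl t)) hVY (hZg t) hYae horth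
  filter_upwards [hmain] with ω hω
  rw [hω, ← sum_inv_mulVec_mul hMsymm]

end Posterior

theorem proposition1
    {Ω : Type*} [MeasurableSpace Ω] (P : Measure Ω) [IsProbabilityMeasure P]
    (α lam σ : ℝ) (hα0 : 0 ≤ α) (hα1 : α < 1) (hlam : 0 < lam) (hσ : 0 < σ)
    -- the known input, the number of measurements and the sampling instants
    (u : ℤ → ℝ) (N : ℕ) (τ : Fin N → ℤ)
    -- the impulse response, the noises and the measurements
    (g : ℕ+ → Ω → ℝ) (e : Fin N → Ω → ℝ) (y : Fin N → Ω → ℝ)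
    (hg_meas : ∀ t, Measurable (g t)) (he_meas : ∀ i, Measurable (e i))
    (hy_meas : ∀ i, Measurable (y i))
    -- `g` is a zero-mean Gaussian process with covariance `lam * α ^ max s t`
    (hg_gauss : IsGaussianProcess g P)
    (hg_mean : ∀ t, ∫ ω, g t ω ∂P = 0)
    (hg_cov : ∀ s t, ∫ ω, g s ω * g t ω ∂P = lam * stableSpline α s t)
    -- the noises are independent, Gaussian, of mean zero and variance `σ ^ 2`
    (he_law : ∀ i, HasLaw (e i) (gaussianReal 0 (Real.toNNReal (σ ^ 2))) P)
    (he_indep : iIndepFun e P)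
    -- the process is independent of the noise
    (hge : IndepFun (fun ω t => g t ω) (fun ω i => e i ω) P)
    -- the convolutions exist, and `y i = (g ⊗ u) (τ i) + e i`
    (hconv : ∀ i, ∀ᵐ ω ∂P, ConvSummable (fun k => g k ω) u (τ i))
    (hy : ∀ i, ∀ᵐ ω ∂P, y i ω = conv (fun k => g k ω) u (τ i) + e i ω) :
    -- expansion of the Brownian motion kernel on `[0, 1]`
    (∀ x ∈ Set.Icc (0 : ℝ) 1, ∀ x' ∈ Set.Icc (0 : ℝ) 1,
      HasSum (fun j : ℕ+ => zeta j * (Real.sqrt 2 * Real.sin (x / Real.sqrt (zeta j))) *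
        (Real.sqrt 2 * Real.sin (x' / Real.sqrt (zeta j)))) (min x x')) ∧
    -- expansion of the stable spline kernel
    (∀ s t : ℕ+, HasSum (fun j : ℕ+ => zeta j * rho α j s * rho α j t) (stableSpline α s t)) ∧
    -- the coefficients `h i j` and the functional to be minimized are well defined
    (∀ i j, ConvSummable (rho α j) u (τ i)) ∧
    (∀ a : ℕ+ → ℝ, (Summable fun j => a j ^ 2 / zeta j) →
      ∀ i, Summable fun j => atomOutput α u τ i j * a j) ∧
    -- the minimization problem has exactly one solution, of finite cost
    (∀ v : Fin N → ℝ, ∃! a : ℕ+ → ℝ, IsRidgeMinimizer α (σ ^ 2 / lam) u τ v a) ∧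
    (∀ (v : Fin N → ℝ) (a : ℕ+ → ℝ), IsRidgeMinimizer α (σ ^ 2 / lam) u τ v a →
      Summable fun j => a j ^ 2 / zeta j) ∧
    -- the posterior mean is the atomic expansion with the minimizing coefficients
    (∀ t : ℕ+, ∀ᵐ ω ∂P, ∀ a : ℕ+ → ℝ,
      IsRidgeMinimizer α (σ ^ 2 / lam) u τ (fun i => y i ω) a →
        HasSum (fun j => a j * rho α j t)
          ((P[g t | MeasurableSpace.comap (fun ω' i => y i ω') inferInstance]) ω)) ∧
    -- the series and the inverse in the closed form are well defined
    (∀ i, ∀ t : ℕ+, ConvSummable (fun k => stableSpline α k t) u (τ i)) ∧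
    (∀ i j, Summable fun t : ℕ+ =>
      u (τ j - (t : ℤ)) * ∑' k : ℕ+, u (τ i - (k : ℤ)) * stableSpline α t k) ∧
    IsUnit (outputKernel α u τ + (σ ^ 2 / lam) • (1 : Matrix (Fin N) (Fin N) ℝ)) ∧
    -- closed form of the posterior mean
    (∀ t : ℕ+, ∀ᵐ ω ∂P,
      (P[g t | MeasurableSpace.comap (fun ω' i => y i ω') inferInstance]) ω =
        ∑ i : Fin N,
          Matrix.mulVec
            (outputKernel α u τ + (σ ^ 2 / lam) • (1 : Matrix (Fin N) (Fin N) ℝ))⁻¹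
            (fun i' => y i' ω) i *
          conv (fun k => stableSpline α k t) u (τ i)) := by
  have hγ : 0 < σ ^ 2 / lam := by positivity
  have hw (i : Fin N) := summable_input_of_convSummable hα0 hlam hg_meas hg_gauss hg_mean hg_cov
    (hconv i)
  have hpost (t : ℕ+) := condExp_eq_sum_gram_inv hα0 hα1 hlam hσ hg_meas he_meas hy_meas hg_gauss
    hg_mean hg_cov he_law he_indep hge hconv hy t
  have hmin := isRidgeMinimizer_iff hα0 hα1 hw hγ
  have hsum {b : lp (fun _ : ℕ+ => ℝ) 2} := (hasSum_sq_atomCoeff_div b).summable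
  refine ⟨fun x hx x' hx' => hasSum_min hx hx', hasSum_stableSpline hα0 hα1,
    fun i j => convSummable_rho hα0 hα1 (hw i) j, ?_, ?_, ?_, ?_,
    fun i t => (hasSum_conv_stableSpline hα0 hα1 (hw i) t).summable,
    fun i j => (hasSum_outputKernel hα0 hα1 hw i j).summable, ?_, ?_⟩
  · intro a ha i
    obtain ⟨b, rfl⟩ := exists_atomCoeff_eq ha
    exact (hasSum_atomOutput_mul_atomCoeff hα0 hα1 hw b i).summable
  · intro v
    exact ⟨_, (hmin v _).2 rfl, fun a ha => (hmin v a).1 ha⟩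
  · intro v a ha
    rw [(hmin v a).1 ha]
    exact hsum
  · intro t
    -- The minimizer is known explicitly for each data vector, so the exceptional null set does not
    -- depend on `a`.
    filter_upwards [hpost t] with ω hω a ha
    rw [(hmin _ a).1 ha, hω]
    convert! hasSum_atomCoeff_mul_rho hα0 hα1 _ t using 1
    rw [hilbertRidgeSolution, inner_sum]
    simp only [inner_smul_right]
  · rw [outputKernel_eq_gram hα0 hα1 hw]
    exact isUnit_gram_add_smul_one _ hγ
  · intro t
    filter_upwards [hpost t] with ω hω
    rw [hω, outputKernel_eq_gram hα0 hα1 hw]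
    simp only [conv_stableSpline hα0 hα1 (hw _)]
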